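/- Let $\Bbbk$ be an algebraically closed field and let $\mathscr{C}$ be a finitary $2$-category over $\Bbbk$, that is, a (strict) $2$-category with finitely many objects, whose morphism categories are $\Bbbk$-linear, additive, idempotent split and Krull-Schmidt, with finitely many isomorphism classes of indecomposable objects and finite dimensional morphism spaces, whose composition is biadditive and $\Bbbk$-bilinear, and whose identity $1$-morphisms are indecomposable. Assume that $\mathscr{C}$ is weakly fiat: it has a weak antiautoequivalence $*$, reversing both $1$- and $2$-morphisms, such that $(F,F^*)$ is a pair of adjoint $1$-morphisms for every $1$-morphism $F$. For isomorphism classes $F,G$ of indecomposable $1$-morphisms write $F\leq_J G$ if $G$ is isomorphic to a direct summand of $H_1\circ F\circ H_2$ for some $1$-morphisms $H_1,H_2$; the equivalence classes of this preorder are the two-sided cells. A finitary $2$-representation $\mathbf{M}$ is a strict $2$-functor assigning to each object $\mathtt{i}$ a small finitary $\Bbbk$-linear category $\mathbf{M}(\mathtt{i})$, to each $1$-morphism an additive functor and to each $2$-morphism a natural transformation, $\Bbbk$-linearly in the $2$-morphisms. On the set $\mathrm{Ind}(\mathbf{M})$ of isomorphism classes of indecomposable objects in all $\mathbf{M}(\mathtt{i})$,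 write $X\to Y$ if $Y$ is isomorphic to a direct summand of $\mathbf{M}(F)X$ for some $1$-morphism $F$. The classes of the equivalence relation generated by this preorder ($X\to Y\to X$) are the vertices of the diagram of $\mathbf{M}$, which is the Hasse diagram of the induced partial order, and $\mathbf{M}$ is transitive if there is exactly one vertex. The apex of a transitive $\mathbf{M}$ is the unique maximal two-sided cell, with respect to $\leq_J$, of the quotient of $\mathscr{C}$ by the annihilator of $\mathbf{M}$, that is, the unique maximal one among the two-sided cells of those $F$ with $\mathbf{M}(\mathrm{id}_F)\neq 0$. Two $2$-representations are equivalent if there is a $2$-natural transformation (natural up to coherent isomorphism) between them all of whose values are equivalences of categories. For transitive finitary $2$-representations $\mathbf{N}$ and $\mathbf{K}$, let $\mathrm{Dext}(\mathbf{N},\mathbf{K})$ be the set of all nonempty sets $\Theta$ of isomorphism classes of indecomposable $1$-morphisms that arise as follows: there are a finitary $2$-representation $\mathbf{M}$ whose diagram has exactly two vertices $\rho,\tau$, and a transitive $2$-subrepresentation $\mathbf{K}'$ of $\mathbf{M}$, given by full additive subcategories closed under direct summands and isomorphisms, such that $\tau$ consists of the indecomposables in $\mathbf{K}'$ and $\rho$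 of the other ones, $\mathbf{K}'$ is equivalent to $\mathbf{K}$, the quotient of $\mathbf{M}$ by the ideal generated by the identity morphisms of all objects of $\mathbf{K}'$ is equivalent to $\mathbf{N}$, there is an edge $\rho\to\tau$ in the diagram, and $\Theta$ is the set of all indecomposable $F$ for which there is $X\in\rho$ such that $\mathbf{M}(F)X$ has a direct summand in $\tau$. Let $\mathbf{K}$ and $\mathbf{N}$ be transitive $2$-representations of $\mathscr{C}$. Then $\mathbf{K}$ has an apex $\mathcal{J}_{\mathbf{K}}$, and, for every $\Theta\in\mathrm{Dext}(\mathbf{N},\mathbf{K})$, every $F\in\Theta$ satisfies $F\leq_J\mathcal{J}_{\mathbf{K}}$ (that is, $F\leq_J G$ for all $G\in\mathcal{J}_{\mathbf{K}}$), and $\Theta\cap\mathcal{J}_{\mathbf{K}}\neq\varnothing$. -/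

import Mathlib

open CategoryTheory CategoryTheory.Limits CategoryTheory.Bicategory

universe w v u w₁ v₁ u₁

namespace FinTwoRep

/-! ### Finitary categories -/

section Categories

variable (A : Type u) [Category.{v} A]

/-- The relation of being isomorphic, on the indecomposable objects of an additive category. -/
def indecSetoid [Preadditive A] [HasBinaryBiproducts A] :
    Setoid {X : A // Indecomposable X} where
  r X Y := Nonempty (X.1 ≅ Y.1)
  iseqv :=
    { refl := fun X => ⟨Iso.refl X.1⟩
      symm := fun ⟨e⟩ => ⟨e.symm⟩
      trans := fun ⟨e⟩ ⟨e'⟩ => ⟨e.trans e'⟩ }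

/-- The set of isomorphism classes of indecomposable objects of an additive category. -/
def IndecClass [Preadditive A] [HasBinaryBiproducts A] : Type u :=
  Quotient (indecSetoid A)

variable {A}

/-- The isomorphism class of an indecomposable object. -/
def IndecClass.mk [Preadditive A] [HasBinaryBiproducts A] (X : A) (hX : Indecomposable X) :
    IndecClass A :=
  Quotient.mk (indecSetoid A) ⟨X, hX⟩

/-- `X` is an object whose isomorphism class is the indecomposable class `x`. -/
def IndecClass.Represents [Preadditive A] [HasBinaryBiproducts A] (X : A) (x : IndecClass A) :
    Prop :=
  ∃ hX : Indecomposable X, IndecClass.mk X hX = x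

/-- `X` is isomorphic to a direct summand of `Y`. -/
def IsSummand [Preadditive A] [HasBinaryBiproducts A] (X Y : A) : Prop :=
  ∃ Z : A, Nonempty (Y ≅ X ⊞ Z)

variable (A)

/-- A finitary `k`-linear category: additive, idempotent split, Krull-Schmidt, with finitely many
isomorphism classes of indecomposable objects and finite dimensional spaces of morphisms.
Additivity consists of the instance arguments together with the zero object. -/
class FinitaryCategory (k : Type*) [Field k] [Preadditive A] [HasBinaryBiproducts A]
    [Linear k A] : Prop extends HasFiniteBiproducts A, IsIdempotentComplete A where
  /-- Every object is a finite direct sum of objects with local endomorphism rings. -/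
  krullSchmidt : ∀ X : A, ∃ (n : ℕ) (f : Fin n → A),
    (∀ i, IsLocalRing (End (f i))) ∧ Nonempty (X ≅ ⨁ f)
  finite_indec : Finite (IndecClass A)
  finite_hom : ∀ X Y : A, Module.Finite k (X ⟶ Y)

end Categories

/-! ### Finitary 2-categories -/

section TwoCategories

variable (C : Type u) [Bicategory.{w, v} C]

/-- Additive structures on the morphism categories that are preserved by composition. -/
class LocallyAdditive where
  homPreadditive : ∀ a b : C, Preadditive (a ⟶ b)
  homBiproducts : ∀ a b : C, HasBinaryBiproducts (a ⟶ b)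
  whiskerLeft_add : ∀ {a b c : C} (f : a ⟶ b) {g h : b ⟶ c} (η θ : g ⟶ h),
    f ◁ (η + θ) = f ◁ η + f ◁ θ
  whiskerRight_add : ∀ {a b c : C} {f g : a ⟶ b} (η θ : f ⟶ g) (h : b ⟶ c),
    (η + θ) ▷ h = η ▷ h + θ ▷ h

attribute [reducible] LocallyAdditive.homPreadditive

attribute [instance] LocallyAdditive.homPreadditive LocallyAdditive.homBiproducts

/-- A finitary 2-category over `k`: a (strict) 2-category with finitely many objects, finitary
`k`-linear morphism categories, biadditive and `k`-bilinear composition, and indecomposable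
identity 1-morphisms. -/
class FinitaryTwoCategory (k : Type*) [Field k] [LocallyAdditive C] extends
    Bicategory.Strict C where
  finite_obj : Finite C
  homLinear : ∀ a b : C, Linear k (a ⟶ b)
  homFinitary : ∀ a b : C, FinitaryCategory (a ⟶ b) k
  whiskerLeft_smul : ∀ {a b c : C} (f : a ⟶ b) {g h : b ⟶ c} (r : k) (η : g ⟶ h),
    f ◁ (r • η) = r • (f ◁ η)
  whiskerRight_smul : ∀ {a b c : C} {f g : a ⟶ b} (r : k) (η : f ⟶ g) (h : b ⟶ c),
    (r • η) ▷ h = r • (η ▷ h)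
  indecomposable_id : ∀ a : C, Indecomposable (𝟙 a)

attribute [reducible] FinitaryTwoCategory.homLinear

attribute [instance] FinitaryTwoCategory.homLinear FinitaryTwoCategory.homFinitary

/-- A weak antiautoequivalence of a 2-category that is the identity on objects: a contravariant
equivalence on morphism categories reversing the composition of 1-morphisms up to coherent natural
isomorphism. -/
structure WeakAntiAutoequivalence where
  /-- The action on morphism categories. -/
  star (a b : C) : (a ⟶ b)ᵒᵖ ⥤ (b ⟶ a)
  isEquivalence : ∀ a b : C, (star a b).IsEquivalence
  /-- Compatibility with identities. -/
  starId (a : C) : (star a a).obj (.op (𝟙 a)) ≅ 𝟙 a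
  /-- Compatibility with composition. -/
  starComp {a b c : C} (f : a ⟶ b) (g : b ⟶ c) :
    (star a c).obj (.op (f ≫ g)) ≅ (star b c).obj (.op g) ≫ (star a b).obj (.op f)
  naturality_left : ∀ {a b c : C} {f f' : a ⟶ b} (η : f ⟶ f') (g : b ⟶ c),
    (star a c).map (η ▷ g).op ≫ (starComp f g).hom =
      (starComp f' g).hom ≫ (star b c).obj (.op g) ◁ (star a b).map η.op
  naturality_right : ∀ {a b c : C} (f : a ⟶ b) {g g' : b ⟶ c} (θ : g ⟶ g'),
    (star a c).map (f ◁ θ).op ≫ (starComp f g).hom =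
      (starComp f g').hom ≫ (star b c).map θ.op ▷ (star a b).obj (.op f)
  associativity : ∀ {a b c d : C} (f : a ⟶ b) (g : b ⟶ c) (h : c ⟶ d),
    (star a d).map (α_ f g h).hom.op ≫ (starComp (f ≫ g) h).hom ≫
        (star c d).obj (.op h) ◁ (starComp f g).hom =
      (starComp f (g ≫ h)).hom ≫ (starComp g h).hom ▷ (star a b).obj (.op f) ≫ (α_ _ _ _).hom
  left_unitality : ∀ {a b : C} (f : a ⟶ b),
    (star a b).map (λ_ f).hom.op ≫ (starComp (𝟙 a) f).hom ≫
      (star a b).obj (.op f) ◁ (starId a).hom ≫ (ρ_ _).hom = 𝟙 _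
  right_unitality : ∀ {a b : C} (f : a ⟶ b),
    (star a b).map (ρ_ f).hom.op ≫ (starComp f (𝟙 b)).hom ≫
      (starId b).hom ▷ (star a b).obj (.op f) ≫ (λ_ _).hom = 𝟙 _

/-- A 2-category is weakly fiat if it has a weak antiautoequivalence `*` such that every
1-morphism `F` and its image `F*` form a pair of adjoint 1-morphisms. (An antiautoequivalence with
this property fixes the objects, because the sources and targets of adjoint 1-morphisms match.) -/
def WeaklyFiat : Prop :=
  ∃ S : WeakAntiAutoequivalence C, ∀ {a b : C} (f : a ⟶ b),
    Nonempty (Bicategory.Adjunction f ((S.star a b).obj (.op f)))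

variable [LocallyAdditive C]

/-- An isomorphism class of indecomposable 1-morphisms. -/
@[ext]
structure IndecOneMor where
  src : C
  tgt : C
  cls : IndecClass (src ⟶ tgt)

variable {C}

/-- The two-sided preorder: `x ≤_J y` if `y` is a direct summand of `H₂ ∘ x ∘ H₁` for some
1-morphisms `H₁` and `H₂`. -/
def JLe (x y : IndecOneMor C) : Prop :=
  ∃ (F : x.src ⟶ x.tgt) (G : y.src ⟶ y.tgt) (H₁ : y.src ⟶ x.src) (H₂ : x.tgt ⟶ y.tgt),
    IndecClass.Represents F x.cls ∧ IndecClass.Represents G y.cls ∧ IsSummand G (H₁ ≫ F ≫ H₂)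

/-- The two-sided cell of `x`, its equivalence class for the two-sided preorder. -/
def twoSidedCell (x : IndecOneMor C) : Set (IndecOneMor C) :=
  {y | JLe x y ∧ JLe y x}

end TwoCategories

/-! ### Finitary 2-representations -/

section TwoRepresentations

set_option linter.checkUnivs false

variable {C : Type u} [Bicategory.{w, v} C]

/-- Two 2-functors to the 2-category of categories are equivalent if there is a 2-natural
transformation between them (natural up to coherent isomorphism) all of whose values are
equivalences of categories. -/
def AreEquivalent (F G : StrictPseudofunctor C Cat.{v₁, u₁}) : Prop :=
  ∃ η : F.toPseudofunctor.StrongTrans G.toPseudofunctor,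
    ∀ a : C, (η.app a).toFunctor.IsEquivalence

variable (k : Type w₁) [Field k] (C)

/-- A finitary 2-representation: a strict 2-functor which assigns to each object a finitary
`k`-linear category, to each 1-morphism an additive functor and to each 2-morphism a natural
transformation, `k`-linearly in the 2-morphisms. -/
structure FinitaryRep [LocallyAdditive C] [FinitaryTwoCategory C k] where
  /-- The underlying 2-functor. -/
  toTwoFunctor : StrictPseudofunctor C Cat.{v₁, u₁}
  preadditive : ∀ a, Preadditive (toTwoFunctor.obj a)
  biproducts : ∀ a, HasBinaryBiproducts (toTwoFunctor.obj a)
  linear : ∀ a, Linear k (toTwoFunctor.obj a)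
  finitary : ∀ a, FinitaryCategory (toTwoFunctor.obj a) k
  additive : ∀ {a b : C} (F : a ⟶ b), (toTwoFunctor.map F).toFunctor.Additive
  map₂_add : ∀ {a b : C} {F G : a ⟶ b} (η θ : F ⟶ G) (X : toTwoFunctor.obj a),
    (toTwoFunctor.map₂ (η + θ)).toNatTrans.app X =
      (toTwoFunctor.map₂ η).toNatTrans.app X + (toTwoFunctor.map₂ θ).toNatTrans.app X
  map₂_smul : ∀ {a b : C} {F G : a ⟶ b} (r : k) (η : F ⟶ G) (X : toTwoFunctor.obj a),
    (toTwoFunctor.map₂ (r • η)).toNatTrans.app X = r • (toTwoFunctor.map₂ η).toNatTrans.app X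

attribute [instance] FinitaryRep.preadditive FinitaryRep.biproducts FinitaryRep.linear
  FinitaryRep.finitary FinitaryRep.additive

variable {k C} [LocallyAdditive C] [FinitaryTwoCategory C k]

namespace FinitaryRep

variable (M : FinitaryRep.{w, v, u, w₁, v₁, u₁} C k)

/-- The category which the 2-representation assigns to the object `a`. -/
abbrev obj (a : C) : Cat.{v₁, u₁} := M.toTwoFunctor.obj a

/-- The functor which the 2-representation assigns to the 1-morphism `F`. -/
abbrev act {a b : C} (F : a ⟶ b) : M.obj a ⥤ M.obj b := (M.toTwoFunctor.map F).toFunctor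

/-- The set `Ind(M)` of isomorphism classes of indecomposable objects in all `M(a)`. -/
@[ext]
structure IndecObj where
  pt : C
  cls : IndecClass (M.obj pt)

variable {M} in
/-- The action preorder `x → y`: some 1-morphism `F` is such that `y` is isomorphic to a direct
summand of `F x`. -/
def Arrow (x y : M.IndecObj) : Prop :=
  ∃ (F : x.pt ⟶ y.pt) (X : M.obj x.pt) (Y : M.obj y.pt),
    IndecClass.Represents X x.cls ∧ IndecClass.Represents Y y.cls ∧ IsSummand Y ((M.act F).obj X)

/-- `M` is transitive if the action preorder is the full relation (on a nonempty set, so that there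
is exactly one equivalence class). -/
def IsTransitive : Prop :=
  Nonempty M.IndecObj ∧ ∀ x y : M.IndecObj, Arrow x y

/-- The vertices of the diagram of `M`: the equivalence classes of the action preorder. -/
def vertices : Set (Set M.IndecObj) :=
  Set.range fun x => {y | Arrow x y ∧ Arrow y x}

variable {M} in
/-- The order on the set of vertices that is induced by the action preorder. -/
def VertexArrow (ρ τ : Set M.IndecObj) : Prop :=
  ∃ x ∈ ρ, ∃ y ∈ τ, Arrow x y

/-- There is an edge between the vertices `ρ` and `τ` of the Hasse diagram, and `ρ → τ`. -/
def IsEdge (ρ τ : Set M.IndecObj) : Prop :=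
  ρ ∈ M.vertices ∧ τ ∈ M.vertices ∧ ρ ≠ τ ∧ VertexArrow ρ τ ∧
    ∀ σ ∈ M.vertices, VertexArrow ρ σ → VertexArrow σ τ → σ = ρ ∨ σ = τ

/-- The set `Θ_{τ,ρ}` of all indecomposable 1-morphisms `F` for which there is `X ∈ ρ` such that
`F X` contains, as a direct summand, some element of `τ`. -/
def decoration (τ ρ : Set M.IndecObj) : Set (IndecOneMor C) :=
  {φ | ∃ x ∈ ρ, ∃ y ∈ τ, ∃ (F : x.pt ⟶ y.pt) (hF : Indecomposable F)
    (X : M.obj x.pt) (Y : M.obj y.pt),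
    φ = ⟨x.pt, y.pt, IndecClass.mk F hF⟩ ∧
      IndecClass.Represents X x.cls ∧ IndecClass.Represents Y y.cls ∧
      IsSummand Y ((M.act F).obj X)}

/-! #### The apex -/

/-- The 2-morphism `η` belongs to the annihilator of `M`. -/
def Annihilates {a b : C} {F G : a ⟶ b} (η : F ⟶ G) : Prop :=
  ∀ X : M.obj a, (M.toTwoFunctor.map₂ η).toNatTrans.app X = 0

/-- The indecomposable 1-morphism `x` remains nonzero in the quotient of the 2-category by the
annihilator of `M`, that is, its identity 2-morphism does not belong to the annihilator. -/
def Survives (x : IndecOneMor C) : Prop :=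
  ∃ F : x.src ⟶ x.tgt, IndecClass.Represents F x.cls ∧ ¬ M.Annihilates (𝟙 F)

/-- `J` is a maximal two-sided cell of the quotient of the 2-category by the annihilator of `M`. -/
def IsMaximalCell (J : Set (IndecOneMor C)) : Prop :=
  ∃ x, M.Survives x ∧ J = twoSidedCell x ∧ ∀ y, M.Survives y → JLe x y → JLe y x

/-- `J` is the apex of `M`: the unique maximal two-sided cell of the quotient of the 2-category by
the annihilator of `M`. -/
def IsApex (J : Set (IndecOneMor C)) : Prop :=
  M.IsMaximalCell J ∧ ∀ J', M.IsMaximalCell J' → J' = J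

end FinitaryRep

/-! ### 2-subrepresentations and quotients -/

/-- A finitary 2-subrepresentation of `M`, given by full additive subcategories of the `M(a)` that
are closed under direct summands (in particular under isomorphisms) and stable under the action. -/
structure SubRep (M : FinitaryRep.{w, v, u, w₁, v₁, u₁} C k) where
  /-- The objects of the subcategories. -/
  mem (a : C) : ObjectProperty (M.obj a)
  zero_mem : ∀ (a : C) (X : M.obj a), IsZero X → mem a X
  biprod_mem : ∀ (a : C) (X Y : M.obj a), mem a X → mem a Y → mem a (X ⊞ Y)
  summand_mem : ∀ (a : C) (X Y : M.obj a), IsSummand X Y → mem a Y → mem a X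
  act_mem : ∀ {a b : C} (F : a ⟶ b) (X : M.obj a), mem a X → mem b ((M.act F).obj X)

section Constructions

variable {A B D : Type u₁} [Category.{v₁} A] [Category.{v₁} B] [Category.{v₁} D]

/-- The restriction of a functor to full subcategories. -/
def restrict (P : ObjectProperty A) (Q : ObjectProperty B) (F : A ⥤ B)
    (h : ∀ X, P X → Q (F.obj X)) : P.FullSubcategory ⥤ Q.FullSubcategory :=
  Q.lift (P.ι ⋙ F) fun X => h X.obj X.property

/-- The restriction of a natural transformation to full subcategories. -/
def restrictNat (P : ObjectProperty A) (Q : ObjectProperty B) {F G : A ⥤ B}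
    (hF : ∀ X, P X → Q (F.obj X)) (hG : ∀ X, P X → Q (G.obj X)) (η : F ⟶ G) :
    restrict P Q F hF ⟶ restrict P Q G hG where
  app X := ObjectProperty.homMk (η.app X.obj)
  naturality X Y f := by
    apply ObjectProperty.hom_ext
    exact η.naturality f.hom

/-- The ideal generated by the identity morphisms of the objects in `P`: its elements are the
sums of morphisms that factor through an object in `P`. -/
def idealOf [Preadditive A] (P : ObjectProperty A) (X Y : A) : AddSubgroup (X ⟶ Y) :=
  AddSubgroup.closure {f | ∃ (Z : A) (a : X ⟶ Z) (b : Z ⟶ Y), P Z ∧ f = a ≫ 𝟙 Z ≫ b}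

/-- Congruence modulo the ideal generated by the identity morphisms of the objects in `P`. -/
def idealRel [Preadditive A] (P : ObjectProperty A) : HomRel A :=
  fun X Y f g => f - g ∈ idealOf P X Y

lemma map_idealRel [Preadditive A] [Preadditive B] (P : ObjectProperty A) (Q : ObjectProperty B)
    (F : A ⥤ B) [F.Additive] (h : ∀ X, P X → Q (F.obj X)) {X Y : A} {f g : X ⟶ Y}
    (hfg : idealRel P f g) : idealRel Q (F.map f) (F.map g) := by
  have key : idealOf P X Y ≤ (idealOf Q (F.obj X) (F.obj Y)).comap F.mapAddHom := by
    refine (AddSubgroup.closure_le _).2 ?_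
    rintro _ ⟨Z, a, b, hZ, rfl⟩
    exact AddSubgroup.subset_closure ⟨F.obj Z, F.map a, F.map b, h Z hZ, by simp⟩
  have := key hfg
  simpa [idealRel] using this

/-- The functor induced on quotient categories. -/
def descend [Preadditive A] [Preadditive B] (P : ObjectProperty A) (Q : ObjectProperty B)
    (F : A ⥤ B) [F.Additive] (h : ∀ X, P X → Q (F.obj X)) :
    CategoryTheory.Quotient (idealRel P) ⥤ CategoryTheory.Quotient (idealRel Q) :=
  CategoryTheory.Quotient.lift _ (F ⋙ CategoryTheory.Quotient.functor _) fun _ _ _ _ hfg =>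
    CategoryTheory.Quotient.sound _ (map_idealRel P Q F h hfg)

/-- The natural transformation induced on quotient categories. -/
def descendNat [Preadditive A] [Preadditive B] (P : ObjectProperty A) (Q : ObjectProperty B)
    {F G : A ⥤ B} [F.Additive] [G.Additive] (hF : ∀ X, P X → Q (F.obj X))
    (hG : ∀ X, P X → Q (G.obj X)) (η : F ⟶ G) :
    descend P Q F hF ⟶ descend P Q G hG where
  app X := (CategoryTheory.Quotient.functor (idealRel Q)).map (η.app X.as)
  naturality := by
    rintro ⟨X⟩ ⟨Y⟩ ⟨f⟩
    exact congrArg (CategoryTheory.Quotient.functor (idealRel Q)).map (η.naturality f)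

lemma restrict_congr (P : ObjectProperty A) (Q : ObjectProperty B) {F G : A ⥤ B} (e : F = G)
    (hF : ∀ X, P X → Q (F.obj X)) (hG : ∀ X, P X → Q (G.obj X)) :
    restrict P Q F hF = restrict P Q G hG := by
  subst e; rfl

lemma descend_congr [Preadditive A] [Preadditive B] (P : ObjectProperty A) (Q : ObjectProperty B)
    {F G : A ⥤ B} [F.Additive] [G.Additive] (e : F = G)
    (hF : ∀ X, P X → Q (F.obj X)) (hG : ∀ X, P X → Q (G.obj X)) :
    descend P Q F hF = descend P Q G hG := by
  subst e; rfl

lemma conj_eqToHom_app {X Y : Cat.{v₁, u₁}} {F F' G' G : X ⟶ Y} (e : F = F') (η : F' ⟶ G')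
    (e' : G' = G) (x : X) :
    (eqToHom e ≫ η ≫ eqToHom e').toNatTrans.app x =
      eqToHom (by rw [e]) ≫ η.toNatTrans.app x ≫ eqToHom (by rw [e']) := by
  subst e e'; simp

lemma conj_eqToHom_hom (P : ObjectProperty A) {X X' Y' Y : P.FullSubcategory} (e : X = X')
    (f : X' ⟶ Y') (e' : Y' = Y) :
    (eqToHom e ≫ f ≫ eqToHom e').hom =
      eqToHom (congrArg ObjectProperty.FullSubcategory.obj e) ≫ f.hom ≫
        eqToHom (congrArg ObjectProperty.FullSubcategory.obj e') := by
  subst e e'; simp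

lemma conj_eqToHom_map (F : A ⥤ B) {X X' Y' Y : A} (e : X = X') (f : X' ⟶ Y') (e' : Y' = Y) :
    F.map (eqToHom e ≫ f ≫ eqToHom e') =
      eqToHom (congrArg F.obj e) ≫ F.map f ≫ eqToHom (congrArg F.obj e') := by
  subst e e'; simp

end Constructions

namespace FinitaryRep

variable (M : FinitaryRep.{w, v, u, w₁, v₁, u₁} C k)

lemma map₂_whiskerLeft_app {a b c : C} (F : a ⟶ b) {G H : b ⟶ c} (η : G ⟶ H) (X : M.obj a) :
    (M.toTwoFunctor.map₂ (F ◁ η)).toNatTrans.app X =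
      eqToHom (by rw [M.toTwoFunctor.map_comp]; rfl) ≫
        (M.toTwoFunctor.map₂ η).toNatTrans.app ((M.act F).obj X) ≫
        eqToHom (by rw [M.toTwoFunctor.map_comp]; rfl) := by
  rw [M.toTwoFunctor.map₂_whisker_left]
  simp [M.toTwoFunctor.mapComp_eq_eqToIso]

lemma map₂_whiskerRight_app {a b c : C} {F G : a ⟶ b} (η : F ⟶ G) (H : b ⟶ c) (X : M.obj a) :
    (M.toTwoFunctor.map₂ (η ▷ H)).toNatTrans.app X =
      eqToHom (by rw [M.toTwoFunctor.map_comp]; rfl) ≫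
        (M.act H).map ((M.toTwoFunctor.map₂ η).toNatTrans.app X) ≫
        eqToHom (by rw [M.toTwoFunctor.map_comp]; rfl) := by
  rw [M.toTwoFunctor.map₂_whisker_right]
  simp [M.toTwoFunctor.mapComp_eq_eqToIso]

end FinitaryRep

namespace SubRep

variable {M : FinitaryRep.{w, v, u, w₁, v₁, u₁} C k} (K : SubRep M)

/-- The 2-functor underlying the 2-subrepresentation. -/
def toTwoFunctor : StrictPseudofunctor C Cat.{v₁, u₁} :=
  haveI : Bicategory.Strict C := FinitaryTwoCategory.toStrict k
  StrictPseudofunctor.mk''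
    { obj := fun a => Cat.of (K.mem a).FullSubcategory
      map := fun {a b} F => (restrict (K.mem a) (K.mem b) (M.act F) (K.act_mem F)).toCatHom
      map₂ := fun {a b F G} η => (restrictNat (K.mem a) (K.mem b) (K.act_mem F) (K.act_mem G)
        (M.toTwoFunctor.map₂ η).toNatTrans).toCatHom₂
      map₂_id := fun {a b} F => by
        ext X
        apply ObjectProperty.hom_ext
        exact congrArg (fun t => t.toNatTrans.app X.obj) (M.toTwoFunctor.map₂_id F)
      map₂_comp := fun {a b F G H} η θ => by
        ext X
        apply ObjectProperty.hom_ext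
        exact congrArg (fun t => t.toNatTrans.app X.obj) (M.toTwoFunctor.map₂_comp η θ)
      map_id := fun a => Cat.ext (restrict_congr _ _
        (congrArg Cat.Hom.toFunctor (M.toTwoFunctor.map_id a)) (K.act_mem _) fun _ h => h)
      map_comp := fun {a b c} F G => Cat.ext (restrict_congr _ _
        (congrArg Cat.Hom.toFunctor (M.toTwoFunctor.map_comp F G)) (K.act_mem _)
        fun _ h => K.act_mem G _ (K.act_mem F _ h))
      map₂_whisker_left := fun {a b c} F {G H} η => by
        ext X
        apply ObjectProperty.hom_ext
        refine (M.map₂_whiskerLeft_app F η X.obj).trans ?_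
        rw [conj_eqToHom_app]
        symm
        exact conj_eqToHom_hom (K.mem c) _ _ _
      map₂_whisker_right := fun {a b c F G} η H => by
        ext X
        apply ObjectProperty.hom_ext
        refine (M.map₂_whiskerRight_app η H X.obj).trans ?_
        rw [conj_eqToHom_app]
        symm
        exact conj_eqToHom_hom (K.mem c) _ _ _ }

/-- The 2-functor underlying the quotient of `M` by the ideal generated by the identity morphisms
of all objects of the 2-subrepresentation. -/
def quotient : StrictPseudofunctor C Cat.{v₁, u₁} :=
  haveI : Bicategory.Strict C := FinitaryTwoCategory.toStrict k
  StrictPseudofunctor.mk''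
    { obj := fun a => Cat.of (CategoryTheory.Quotient (idealRel (K.mem a)))
      map := fun {a b} F => (descend (K.mem a) (K.mem b) (M.act F) (K.act_mem F)).toCatHom
      map₂ := fun {a b F G} η => (descendNat (K.mem a) (K.mem b) (K.act_mem F) (K.act_mem G)
        (M.toTwoFunctor.map₂ η).toNatTrans).toCatHom₂
      map₂_id := fun {a b} F => by
        ext X
        exact congrArg (fun t => (CategoryTheory.Quotient.functor (idealRel (K.mem b))).map
          (t.toNatTrans.app X.as)) (M.toTwoFunctor.map₂_id F)
      map₂_comp := fun {a b F G H} η θ => by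
        ext X
        exact congrArg (fun t => (CategoryTheory.Quotient.functor (idealRel (K.mem b))).map
          (t.toNatTrans.app X.as)) (M.toTwoFunctor.map₂_comp η θ)
      map_id := fun a => Cat.ext <| by
        refine (descend_congr (G := 𝟭 _) _ _
          (congrArg Cat.Hom.toFunctor (M.toTwoFunctor.map_id a)) (K.act_mem _) fun _ h => h).trans ?_
        exact CategoryTheory.Quotient.lift_unique' _ _ _ rfl
      map_comp := fun {a b c} F G => Cat.ext <| by
        refine (descend_congr (G := M.act F ⋙ M.act G) _ _
          (congrArg Cat.Hom.toFunctor (M.toTwoFunctor.map_comp F G)) (K.act_mem _)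
          fun _ h => K.act_mem G _ (K.act_mem F _ h)).trans ?_
        exact CategoryTheory.Quotient.lift_unique' _ _ _ rfl
      map₂_whisker_left := fun {a b c} F {G H} η => by
        ext X
        refine (congrArg (CategoryTheory.Quotient.functor (idealRel (K.mem c))).map
          (M.map₂_whiskerLeft_app F η X.as)).trans ?_
        rw [conj_eqToHom_app]
        exact conj_eqToHom_map _ _ _ _
      map₂_whisker_right := fun {a b c F G} η H => by
        ext X
        refine (congrArg (CategoryTheory.Quotient.functor (idealRel (K.mem c))).map
          (M.map₂_whiskerRight_app η H X.as)).trans ?_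
        rw [conj_eqToHom_app]
        exact conj_eqToHom_map _ _ _ _ }

/-- The isomorphism classes of indecomposable objects of `M` that lie in `K`. -/
def indec : Set M.IndecObj :=
  {x | ∃ X : M.obj x.pt, IndecClass.Represents X x.cls ∧ K.mem x.pt X}

/-- `K` is transitive as a 2-representation. -/
def IsTransitive : Prop :=
  K.indec.Nonempty ∧ ∀ x ∈ K.indec, ∀ y ∈ K.indec, FinitaryRep.Arrow x y

/-- The discrete extension of `N = M / K` by `K` that corresponds to `M`: the decoration of the edge
from the vertex `ρ` of `N` (the indecomposables outside `K`) to the vertex `τ` of `K` if there is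
such an edge, and the empty set otherwise. -/
def extensionSet : Set (IndecOneMor C) :=
  {φ | M.IsEdge K.indecᶜ K.indec ∧ φ ∈ M.decoration K.indec K.indecᶜ}

end SubRep

/-- The set `Dext(N', K')` of discrete extensions of `N'` by `K'`: all nonempty sets `Θ` that
represent the discrete extension corresponding to some `M` with exactly two vertices in its diagram,
in a short exact sequence `0 → K → M → N → 0` in which `K` is a transitive 2-subrepresentation
equivalent to `K'` and the quotient `N` is equivalent to `N'`. -/
def Dext (N' K' : FinitaryRep.{w, v, u, w₁, v₁, u₁} C k) : Set (Set (IndecOneMor C)) :=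
  {Θ | Θ.Nonempty ∧ ∃ (M : FinitaryRep.{w, v, u, w₁, v₁, u₁} C k) (K : SubRep M),
    M.vertices.ncard = 2 ∧ K.IsTransitive ∧
      AreEquivalent K.toTwoFunctor K'.toTwoFunctor ∧
      AreEquivalent K.quotient N'.toTwoFunctor ∧
      Θ = K.extensionSet}

end TwoRepresentations

end FinTwoRep

/-! Say that a 1-morphism survives in a transitive 2-representation if it acts there by a nonzero
functor. Survivors are directed for `JLe`: if `F X ≠ 0` and `G Y ≠ 0`, transitivity gives `H` such
that `G H F` is nonzero at `X`, and an indecomposable summand of this composite surviving at `X`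
lies above both `F` and `G`. By finiteness there is a greatest survivor `z`, and its cell is the
apex.

Let `F` lie in an extension set and let `Y`, in the subrepresentation, be a summand of `F X`. The
projection `F X → Y` factors through `F F* Y` by adjunction, and `F* Y` lies in the
subrepresentation. As `Y ≠ 0`, `F` does not annihilate the subrepresentation, so `F ≤ z`
(`exists_not_isZero_of_retract`, with `forall_isZero_iff` to pass to `K`).

To meet the apex, let `G` represent `z` and pick an indecomposable `Y'` in the subrepresentation
with `G Y' ≠ 0`. Transitivity gives `H` with `Y'` a summand of `H Y`. An indecomposable summand `W`
of `G Y'` is then a summand of `G H F X`, hence of `L X` for some indecomposable summand `L` of `G H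
F` (`exists_retract_map`). This `L` is in the extension set and `z ≤ L ≤ z`. -/

namespace FinTwoRep

/-! ### Retracts and local endomorphism rings in additive categories -/

section Categories

variable {A : Type u} [Category.{v} A]

lemma isZero_of_retract [HasZeroMorphisms A] {X Y : A} (h : Retract X Y) (hY : IsZero Y) :
    IsZero X := by
  rw [IsZero.iff_id_eq_zero, ← h.retract, hY.eq_of_tgt h.i 0, zero_comp]

lemma isZero_obj_iff [HasZeroMorphisms A] {B : Type*} [Category B] [HasZeroMorphisms B]
    (T : A ⥤ B) [T.IsEquivalence] (X : A) : IsZero (T.obj X) ↔ IsZero X := by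
  rw [IsZero.iff_id_eq_zero, IsZero.iff_id_eq_zero, ← T.map_id, T.map_eq_zero_iff]

lemma IsSummand.retract [Preadditive A] [HasBinaryBiproducts A] {X Y : A} (h : IsSummand X Y) :
    Nonempty (Retract X Y) := by
  obtain ⟨Z, ⟨e⟩⟩ := h
  exact ⟨{ i := biprod.inl ≫ e.inv, r := e.hom ≫ biprod.fst }⟩

/-- The complement is the image of the idempotent `𝟙 Y - h.r ≫ h.i`. Retracts are preserved by every
functor and compose, so arguments use them and return to summands only at the end. -/
lemma isSummand_of_retract [Preadditive A] [HasBinaryBiproducts A] [IsIdempotentComplete A]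
    {X Y : A} (h : Retract X Y) : IsSummand X Y := by
  have hi : (𝟙 Y - h.r ≫ h.i) ≫ (𝟙 Y - h.r ≫ h.i) = 𝟙 Y - h.r ≫ h.i := by simp
  obtain ⟨Z, i, e, hie, hei⟩ := IsIdempotentComplete.idempotents_split Y _ hi
  have hiX : i ≫ h.r = 0 := by
    have : i = i ≫ (𝟙 Y - h.r ≫ h.i) := by rw [← hei, reassoc_of% hie]
    rw [this]; simp
  have hXe : h.i ≫ e = 0 := by
    have : e = (𝟙 Y - h.r ≫ h.i) ≫ e := by rw [← hei, Category.assoc, hie, Category.comp_id]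
    rw [this]; simp
  refine ⟨Z, ⟨⟨biprod.lift h.r e, biprod.desc h.i i, ?_, ?_⟩⟩⟩
  · rw [biprod.lift_desc, hei]; abel
  · ext <;> simp [hie, hiX, hXe]

lemma _root_.IsLocalRing.eq_zero_or_one_of_isIdempotentElem {R : Type*} [Ring R] [IsLocalRing R]
    {e : R} (he : IsIdempotentElem e) : e = 0 ∨ e = 1 := by
  have hu : ∀ f : R, f * f = f → IsUnit f → f = 1 := fun f hf hfu =>
    hfu.mul_left_cancel (by rw [hf, mul_one])
  rcases IsLocalRing.isUnit_or_isUnit_of_add_one (add_sub_cancel e 1) with h | h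
  · exact Or.inr (hu _ he h)
  · exact Or.inl (sub_eq_self.1 (hu (1 - e) he.one_sub h))

/-- Nonunits of a local ring are closed under finite sums, and `1` is a unit. -/
lemma _root_.IsLocalRing.exists_isUnit_of_sum_eq_one {R ι : Type*} [Ring R] [IsLocalRing R]
    [Fintype ι] (f : ι → R) (h : ∑ i, f i = 1) : ∃ i, IsUnit (f i) := by
  by_contra! H
  have : ∀ s : Finset ι, ¬ IsUnit (∑ i ∈ s, f i) := by
    intro s
    induction s using Finset.cons_induction with
    | empty => simp
    | cons i s hi ih =>
      rw [Finset.sum_cons]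
      exact fun hu => (IsLocalRing.isUnit_or_isUnit_of_isUnit_add hu).elim (H i) ih
  exact this Finset.univ (h ▸ isUnit_one)

/-- A decomposition yields an idempotent endomorphism, the projection onto the first factor.
Locality forces it to be `0` or `1`, which kills one of the two factors. -/
lemma indecomposable_of_isLocalRing [Preadditive A] [HasBinaryBiproducts A] {X : A}
    (h : IsLocalRing (End X)) : Indecomposable X := by
  refine ⟨fun hX => zero_ne_one (α := End X) (hX.eq_of_src _ _), fun Y Z e => ?_⟩
  have he : (e.hom ≫ biprod.fst ≫ biprod.inl ≫ e.inv) ≫ e.hom ≫ biprod.fst ≫ biprod.inl ≫ e.inv =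
      e.hom ≫ biprod.fst ≫ biprod.inl ≫ e.inv := by simp
  rcases IsLocalRing.eq_zero_or_one_of_isIdempotentElem (R := End X) he with h0 | h1
  · left
    rw [IsZero.iff_id_eq_zero]
    have := congrArg (fun t : X ⟶ X => biprod.inl ≫ e.inv ≫ t ≫ e.hom ≫ biprod.fst) h0
    simpa using this
  · right
    rw [IsZero.iff_id_eq_zero]
    have := congrArg (fun t : X ⟶ X => biprod.inr ≫ e.inv ≫ t ≫ e.hom ≫ biprod.snd) h1
    simpa using this.symm

/-- A decomposition of the identity of an object into finitely many retractions onto objects with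
local endomorphism rings. -/
lemma FinitaryCategory.exists_retracts (k : Type*) [Field k] [Preadditive A]
    [HasBinaryBiproducts A] [Linear k A] [FinitaryCategory A k] (X : A) :
    ∃ (n : ℕ) (f : Fin n → A) (h : ∀ i, Retract (f i) X),
      (∀ i, IsLocalRing (End (f i))) ∧ ∑ i, (h i).r ≫ (h i).i = 𝟙 X := by
  have : HasFiniteBiproducts A := FinitaryCategory.toHasFiniteBiproducts k
  obtain ⟨n, f, hf, ⟨e⟩⟩ := FinitaryCategory.krullSchmidt (k := k) X
  refine ⟨n, f, fun i => { i := biproduct.ι f i ≫ e.inv, r := e.hom ≫ biproduct.π f i }, hf, ?_⟩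
  have : ∀ i, (e.hom ≫ biproduct.π f i) ≫ biproduct.ι f i ≫ e.inv =
      e.hom ≫ (biproduct.π f i ≫ biproduct.ι f i) ≫ e.inv := fun i => by simp
  simp only [this, ← Preadditive.comp_sum, ← Preadditive.sum_comp, biproduct.total]
  simp

/-- If `T` killed every local summand of `X`, it would kill the decomposition of `𝟙 X`. `T` will be
an action functor, an evaluation at an object, or the identity. -/
lemma FinitaryCategory.exists_local_retract_not_isZero (k : Type*) [Field k] [Preadditive A]
    [HasBinaryBiproducts A] [Linear k A] [FinitaryCategory A k] {B : Type*} [Category B]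
    [Preadditive B] (T : A ⥤ B) [T.Additive] {X : A} (hX : ¬ IsZero (T.obj X)) :
    ∃ (Y : A) (_ : Retract Y X), IsLocalRing (End Y) ∧ ¬ IsZero (T.obj Y) := by
  obtain ⟨n, f, h, hf, hs⟩ := FinitaryCategory.exists_retracts k X
  by_contra! H
  refine hX ?_
  rw [IsZero.iff_id_eq_zero, ← T.map_id, ← hs, T.map_sum]
  refine Finset.sum_eq_zero fun i _ => ?_
  rw [T.map_comp, (H (f i) (h i) (hf i)).eq_of_tgt (T.map (h i).r) 0, zero_comp]

lemma FinitaryCategory.exists_local_retract (k : Type*) [Field k] [Preadditive A]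
    [HasBinaryBiproducts A] [Linear k A] [FinitaryCategory A k] {X : A} (hX : ¬ IsZero X) :
    ∃ (Y : A) (_ : Retract Y X), IsLocalRing (End Y) :=
  have ⟨Y, h, hY, _⟩ := FinitaryCategory.exists_local_retract_not_isZero k (𝟭 A) hX
  ⟨Y, h, hY⟩

/-- An object with local endomorphism ring which is a retract of the value of an additive functor
at `X` is a retract of its value at some indecomposable summand of `X`. -/
lemma FinitaryCategory.exists_retract_map (k : Type*) [Field k] [Preadditive A]
    [HasBinaryBiproducts A] [Linear k A] [FinitaryCategory A k] {B : Type*} [Category B]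
    [Preadditive B] (T : A ⥤ B) [T.Additive] {X : A} {W : B} [IsLocalRing (End W)]
    (hW : Retract W (T.obj X)) :
    ∃ (Y : A) (_ : Retract Y X) (_ : Retract W (T.obj Y)), IsLocalRing (End Y) := by
  obtain ⟨n, f, h, hf, hs⟩ := FinitaryCategory.exists_retracts k X
  -- The part of `𝟙 W` passing through the `i`-th summand of `X`; these parts add up to `1` in the
  -- local ring `End W`.
  let φ (i : Fin n) : End W := hW.i ≫ (T.map (h i).r ≫ T.map (h i).i) ≫ hW.r
  have hsum : ∑ i, φ i = 1 := by
    have : ∑ i, (T.map (h i).r ≫ T.map (h i).i) = 𝟙 (T.obj X) := by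
      simp only [← T.map_comp, ← T.map_sum, hs, T.map_id]
    change ∑ i, (hW.i ≫ (T.map (h i).r ≫ T.map (h i).i) ≫ hW.r) = 𝟙 W
    rw [← Preadditive.comp_sum, ← Preadditive.sum_comp, this]
    simp
  obtain ⟨i, hi⟩ := IsLocalRing.exists_isUnit_of_sum_eq_one φ hsum
  rw [isUnit_iff_exists] at hi
  -- Multiplication in `End W` reverses composition, so `g * φ i = 1` is the equation `φ i ≫ g = 𝟙
  -- W` that makes `g` correct the retraction.
  obtain ⟨g, -, hg⟩ := hi
  replace hg : (hW.i ≫ (T.map (h i).r ≫ T.map (h i).i) ≫ hW.r) ≫ g = 𝟙 W := hg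
  exact ⟨f i, h i, { i := hW.i ≫ T.map (h i).r, r := T.map (h i).i ≫ hW.r ≫ g
                     retract := by simpa using hg }, hf i⟩

end Categories

/-! ### The two-sided preorder on indecomposable 1-morphisms -/

section TwoCategories

variable {C : Type u} [Bicategory.{w, v} C]

lemma IndecClass.exists_represents {A : Type u} [Category.{v} A] [Preadditive A]
    [HasBinaryBiproducts A] (x : IndecClass A) : ∃ X : A, IndecClass.Represents X x := by
  obtain ⟨⟨X, hX⟩, rfl⟩ := Quotient.exists_rep x
  exact ⟨X, hX, rfl⟩

lemma IndecClass.represents_mk {A : Type u} [Category.{v} A] [Preadditive A]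
    [HasBinaryBiproducts A] {X : A} (hX : Indecomposable X) :
    IndecClass.Represents X (IndecClass.mk X hX) := ⟨hX, rfl⟩

lemma IndecClass.Represents.nonempty_iso {A : Type u} [Category.{v} A] [Preadditive A]
    [HasBinaryBiproducts A] {X Y : A} {x : IndecClass A} (hX : IndecClass.Represents X x)
    (hY : IndecClass.Represents Y x) : Nonempty (X ≅ Y) := by
  obtain ⟨_, rfl⟩ := hX
  obtain ⟨_, h⟩ := hY
  exact (Quotient.exact h.symm :)

variable [LocallyAdditive C]

/-- The representatives hidden in `JLe` can be replaced by any others, since whiskering preserves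
isomorphisms. -/
lemma JLe.exists_retract {x y : IndecOneMor C} (h : JLe x y) {F : x.src ⟶ x.tgt}
    {G : y.src ⟶ y.tgt} (hF : IndecClass.Represents F x.cls) (hG : IndecClass.Represents G y.cls) :
    ∃ (H₁ : y.src ⟶ x.src) (H₂ : x.tgt ⟶ y.tgt), Nonempty (Retract G (H₁ ≫ F ≫ H₂)) := by
  obtain ⟨F', G', H₁, H₂, hF', hG', hs⟩ := h
  obtain ⟨r⟩ := hs.retract
  obtain ⟨e⟩ := hF'.nonempty_iso hF
  obtain ⟨e'⟩ := hG.nonempty_iso hG'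
  exact ⟨H₁, H₂, ⟨((Retract.ofIso e').trans r).trans
    (Retract.ofIso (whiskerLeftIso H₁ (whiskerRightIso e H₂)))⟩⟩

variable (k : Type w₁) [Field k] [FinitaryTwoCategory C k]

include k in
lemma jLe_of_retract {x y : IndecOneMor C} {F : x.src ⟶ x.tgt}
    {G : y.src ⟶ y.tgt} (hF : IndecClass.Represents F x.cls) (hG : IndecClass.Represents G y.cls)
    (H₁ : y.src ⟶ x.src) (H₂ : x.tgt ⟶ y.tgt) (r : Retract G (H₁ ≫ F ≫ H₂)) : JLe x y :=
  have : IsIdempotentComplete (y.src ⟶ y.tgt) := FinitaryCategory.toIsIdempotentComplete k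
  ⟨F, G, H₁, H₂, hF, hG, isSummand_of_retract r⟩

include k in
lemma JLe.trans {x y z : IndecOneMor C} (h : JLe x y) (h' : JLe y z) : JLe x z := by
  obtain ⟨F, hF⟩ := x.cls.exists_represents
  obtain ⟨G, hG⟩ := y.cls.exists_represents
  obtain ⟨H, hH⟩ := z.cls.exists_represents
  obtain ⟨A, B, ⟨r⟩⟩ := h.exists_retract hF hG
  obtain ⟨A', B', ⟨r'⟩⟩ := h'.exists_retract hG hH
  refine jLe_of_retract k hF hH (A' ≫ A) (B ≫ B') ?_
  refine (r'.trans ((r.map (postcomp _ B')).map (precomp _ A'))).trans (Retract.ofIso ?_)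
  exact whiskerLeftIso A' (α_ A (F ≫ B) B' ≪≫ whiskerLeftIso A (α_ F B B')) ≪≫ (α_ _ _ _).symm

include k in
lemma finite_indecOneMor : Finite (IndecOneMor C) := by
  have : Finite C := FinitaryTwoCategory.finite_obj k
  have : ∀ a b : C, Finite (IndecClass (a ⟶ b)) := fun a b => FinitaryCategory.finite_indec k
  exact Finite.of_injective
    (β := Σ a : C, Σ b : C, IndecClass (a ⟶ b)) (fun x => ⟨x.src, x.tgt, x.cls⟩) fun x y h => by
      obtain ⟨a, b, c⟩ := x
      obtain ⟨a', b', c'⟩ := y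
      obtain ⟨rfl, h⟩ := Sigma.mk.inj h
      obtain ⟨rfl, h⟩ := Sigma.mk.inj (eq_of_heq h)
      cases h
      rfl

end TwoCategories

/-! ### Surviving 1-morphisms and the apex -/

section TwoRepresentations

set_option linter.checkUnivs false

variable {C : Type u} [Bicategory.{w, v} C] {k : Type w₁} [Field k] [LocallyAdditive C]
  [FinitaryTwoCategory C k]

namespace FinitaryRep

variable (M : FinitaryRep.{w, v, u, w₁, v₁, u₁} C k)

/-- Evaluation of 1-morphisms at an object of a 2-representation. -/
def evaluation {a : C} (X : M.obj a) (b : C) : (a ⟶ b) ⥤ M.obj b where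
  obj F := (M.act F).obj X
  map η := (M.toTwoFunctor.map₂ η).toNatTrans.app X
  map_id F := by simp
  map_comp η θ := by simp

instance {a : C} (X : M.obj a) (b : C) : (M.evaluation X b).Additive where
  map_add := M.map₂_add _ _ X

/-- The action of a composition is the composition of the actions. -/
def actCompIso {a b c : C} (F : a ⟶ b) (G : b ⟶ c) (X : M.obj a) :
    (M.act (F ≫ G)).obj X ≅ (M.act G).obj ((M.act F).obj X) :=
  (Cat.Hom.toNatIso (M.toTwoFunctor.mapComp F G)).app X

/-- The action preserves adjunctions. -/
def actAdjunction {a b : C} {F : a ⟶ b} {G : b ⟶ a} (adj : Bicategory.Adjunction F G) :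
    M.act F ⊣ M.act G :=
  CategoryTheory.Adjunction.ofCat (M.toTwoFunctor.toPseudofunctor.mapAdjunction adj)

lemma annihilates_id_iff {a b : C} (F : a ⟶ b) :
    M.Annihilates (𝟙 F) ↔ ∀ X, IsZero ((M.act F).obj X) := by
  simp only [Annihilates, IsZero.iff_id_eq_zero]
  exact forall_congr' fun X => by
    rw [show (M.toTwoFunctor.map₂ (𝟙 F)).toNatTrans.app X = 𝟙 _ from (M.evaluation X b).map_id F]

variable {M} in
lemma Survives.exists_not_isZero {x : IndecOneMor C} (hx : M.Survives x) {F : x.src ⟶ x.tgt}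
    (hF : IndecClass.Represents F x.cls) : ∃ X, ¬ IsZero ((M.act F).obj X) := by
  obtain ⟨G, hG, h⟩ := hx
  rw [annihilates_id_iff] at h
  push Not at h
  obtain ⟨X, hX⟩ := h
  obtain ⟨e⟩ := hF.nonempty_iso hG
  exact ⟨X, fun h => hX (h.of_iso ((M.evaluation X _).mapIso e).symm)⟩

lemma survives_of_not_isZero {x : IndecOneMor C} {F : x.src ⟶ x.tgt}
    (hF : IndecClass.Represents F x.cls) {X : M.obj x.src} (hX : ¬ IsZero ((M.act F).obj X)) :
    M.Survives x :=
  ⟨F, hF, fun h => hX ((M.annihilates_id_iff F).1 h X)⟩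

variable {M} in
lemma Arrow.exists_retract {x y : M.IndecObj} (h : Arrow x y) {X : M.obj x.pt} {Y : M.obj y.pt}
    (hX : IndecClass.Represents X x.cls) (hY : IndecClass.Represents Y y.cls) :
    ∃ F : x.pt ⟶ y.pt, Nonempty (Retract Y ((M.act F).obj X)) := by
  obtain ⟨F, X', Y', hX', hY', hs⟩ := h
  obtain ⟨r⟩ := hs.retract
  obtain ⟨e⟩ := hX'.nonempty_iso hX
  obtain ⟨e'⟩ := hY.nonempty_iso hY'
  exact ⟨F, ⟨((Retract.ofIso e').trans r).trans (Retract.ofIso ((M.act F).mapIso e))⟩⟩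

/-- In a transitive 2-representation, any two surviving 1-morphisms have a surviving upper bound
for the two-sided preorder. -/
lemma IsTransitive.exists_survives_jLe (hM : M.IsTransitive) {x y : IndecOneMor C}
    (hx : M.Survives x) (hy : M.Survives y) : ∃ z, M.Survives z ∧ JLe x z ∧ JLe y z := by
  obtain ⟨F, hF⟩ := x.cls.exists_represents
  obtain ⟨G, hG⟩ := y.cls.exists_represents
  obtain ⟨X, hX⟩ := hx.exists_not_isZero hF
  obtain ⟨Y₀, hY₀⟩ := hy.exists_not_isZero hG
  obtain ⟨X', rX, hX'⟩ := FinitaryCategory.exists_local_retract k hX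
  obtain ⟨Y, -, hY, hGY⟩ := FinitaryCategory.exists_local_retract_not_isZero k (M.act G) hY₀
  have hX' := indecomposable_of_isLocalRing hX'
  have hY := indecomposable_of_isLocalRing hY
  -- Transitivity links a summand `X'` of `F X` to an object `Y` that `G` does not kill.
  obtain ⟨H, ⟨r⟩⟩ := (hM.2 ⟨_, .mk X' hX'⟩ ⟨_, .mk Y hY⟩).exists_retract
    (IndecClass.represents_mk hX') (IndecClass.represents_mk hY)
  have hZ : ¬ IsZero ((M.act (F ≫ H ≫ G)).obj X) := fun h =>
    hGY (isZero_of_retract ((r.trans (rX.map (M.act H))).map (M.act G))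
      (h.of_iso (M.actCompIso F (H ≫ G) X ≪≫ M.actCompIso H G _).symm))
  -- The composite may decompose; evaluation at `X` selects an indecomposable summand that is still
  -- nonzero there.
  obtain ⟨L, rL, hL, hLX⟩ := FinitaryCategory.exists_local_retract_not_isZero k
    (M.evaluation X y.tgt) hZ
  have hL := IndecClass.represents_mk (indecomposable_of_isLocalRing hL)
  let z : IndecOneMor C := ⟨x.src, y.tgt, .mk L hL.1⟩
  refine ⟨z, M.survives_of_not_isZero (x := z) hL hLX, ?_, ?_⟩
  · exact jLe_of_retract (y := z) k hF hL (𝟙 _) (H ≫ G) (rL.trans (Retract.ofIso (λ_ _).symm))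
  · exact jLe_of_retract (y := z) k hG hL (F ≫ H) (𝟙 _)
      (rL.trans (Retract.ofIso ((α_ _ _ _).symm ≪≫ whiskerLeftIso _ (ρ_ _).symm)))

/-- The identity 1-morphism survives at any object `p` for which `M(p)` has an indecomposable. -/
lemma IsTransitive.exists_survives (hM : M.IsTransitive) : ∃ x, M.Survives x := by
  obtain ⟨⟨p, c⟩⟩ := hM.1
  obtain ⟨X, hX, -⟩ := c.exists_represents
  have h1 := FinitaryTwoCategory.indecomposable_id (C := C) k p
  refine ⟨⟨p, p, .mk (𝟙 p) h1⟩, M.survives_of_not_isZero (X := X)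
    (IndecClass.represents_mk h1) fun h => hX.1 (h.of_iso ?_)⟩
  exact ((Cat.Hom.toNatIso (M.toTwoFunctor.mapId p)).app X).symm

/-- In a transitive 2-representation, the surviving 1-morphisms have a greatest element for the
two-sided preorder. -/
lemma IsTransitive.exists_survives_forall_jLe (hM : M.IsTransitive) :
    ∃ z, M.Survives z ∧ ∀ y, M.Survives y → JLe y z := by
  have := finite_indecOneMor (C := C) k
  have : Nonempty {x // M.Survives x} := have ⟨x, hx⟩ := hM.exists_survives; ⟨⟨x, hx⟩⟩
  have : IsTrans (IndecOneMor C) JLe := ⟨fun _ _ _ => JLe.trans k⟩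
  have hd : Directed JLe (Subtype.val : {x // M.Survives x} → IndecOneMor C) := fun x y =>
    have ⟨z, hz, h⟩ := hM.exists_survives_jLe M x.2 y.2
    ⟨⟨z, hz⟩, h⟩
  -- The bounded family consists of all survivors, so its upper bound is a greatest element.
  obtain ⟨z, hz⟩ := hd.finite_le (id : {x // M.Survives x} → _)
  exact ⟨z, z.2, fun y hy => hz ⟨y, hy⟩⟩

/-- Any maximal survivor lies below the greatest one, hence is equivalent to it and has the same
cell. -/
lemma isApex_twoSidedCell {z : IndecOneMor C} (hz : M.Survives z)
    (h : ∀ y, M.Survives y → JLe y z) : M.IsApex (twoSidedCell z) := by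
  refine ⟨⟨z, hz, rfl, fun y hy _ => h y hy⟩, ?_⟩
  rintro _ ⟨x, hx, rfl, hmax⟩
  have hxz := h x hx
  have hzx := hmax z hz hxz
  ext y
  exact ⟨fun hy => ⟨hzx.trans k hy.1, hy.2.trans k hxz⟩,
    fun hy => ⟨hxz.trans k hy.1, hy.2.trans k hzx⟩⟩

end FinitaryRep

/-! ### Vanishing of actions on 2-subrepresentations -/

namespace SubRep

variable {M : FinitaryRep.{w, v, u, w₁, v₁, u₁} C k} (K : SubRep M)

lemma mem_of_retract {a : C} {X Y : M.obj a} (r : Retract X Y) (hY : K.mem a Y) : K.mem a X :=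
  have : IsIdempotentComplete (M.obj a) := FinitaryCategory.toIsIdempotentComplete k
  K.summand_mem a X Y (isSummand_of_retract r) hY

lemma mem_of_mem_indec {x : M.IndecObj} (hx : x ∈ K.indec) {X : M.obj x.pt}
    (hX : IndecClass.Represents X x.cls) : K.mem x.pt X := by
  obtain ⟨Y, hY, h⟩ := hx
  exact K.mem_of_retract (Retract.ofIso (hX.nonempty_iso hY).some) h

lemma isZero_iff {a : C} (X : (K.mem a).FullSubcategory) : IsZero X ↔ IsZero X.obj := by
  rw [IsZero.iff_id_eq_zero, IsZero.iff_id_eq_zero]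
  exact ⟨fun h => congrArg (fun t => t.hom) h, fun h => ObjectProperty.hom_ext _ h⟩

/-- Whether the action of a 1-morphism on a 2-subrepresentation is zero only depends on the
equivalence class of the 2-subrepresentation. -/
lemma forall_isZero_iff {N : FinitaryRep.{w, v, u, w₁, v₁, u₁} C k}
    (h : AreEquivalent K.toTwoFunctor N.toTwoFunctor) {a b : C} (F : a ⟶ b) :
    (∀ X, K.mem a X → IsZero ((M.act F).obj X)) ↔ ∀ X, IsZero ((N.act F).obj X) := by
  obtain ⟨η, hη⟩ := h
  have e : ∀ X : (K.mem a).FullSubcategory,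
      (η.app b).toFunctor.obj ((K.toTwoFunctor.map F).toFunctor.obj X) ≅
        (N.act F).obj ((η.app a).toFunctor.obj X) :=
    fun X => (Cat.Hom.toNatIso (η.naturality F)).app X
  have := hη a
  have hz : ∀ X : (K.mem a).FullSubcategory,
      IsZero ((M.act F).obj X.obj) ↔ IsZero ((N.act F).obj ((η.app a).toFunctor.obj X)) := by
    intro X
    refine Iff.trans (K.isZero_iff ((K.toTwoFunctor.map F).toFunctor.obj X)).symm ?_
    refine Iff.trans ?_ (e X).isZero_iff
    let E : (K.mem b).FullSubcategory ⥤ N.obj b := (η.app b).toFunctor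
    have : E.IsEquivalence := hη b
    exact (isZero_obj_iff E _).symm
  constructor
  · intro H X
    -- Essential surjectivity reduces to objects in the image of the equivalence.
    let e' := (η.app a).toFunctor.objObjPreimageIso X
    exact (((hz ((η.app a).toFunctor.objPreimage X)).1
      (H _ ((η.app a).toFunctor.objPreimage X).property))).of_iso ((N.act F).mapIso e').symm
  · exact fun H X hX => (hz ⟨X, hX⟩).2 (H _)

/-- A 1-morphism with a right adjoint which sends some object to an object having a nonzero summand
in a 2-subrepresentation does not annihilate this 2-subrepresentation. -/
lemma exists_not_isZero_of_retract {a b : C} {F : a ⟶ b} {G : b ⟶ a}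
    (adj : Bicategory.Adjunction F G) {X : M.obj a} {Y : M.obj b} (hY : ¬ IsZero Y)
    (hYK : K.mem b Y) (r : Retract Y ((M.act F).obj X)) :
    ∃ Z, K.mem a Z ∧ ¬ IsZero ((M.act F).obj Z) := by
  refine ⟨(M.act G).obj Y, K.act_mem G Y hYK, fun h => hY ?_⟩
  -- The projection onto `Y` is the counit at `Y` after `F` applied to its transpose `X → G Y`, so
  -- it factors through `F G Y`.
  have hr : r.r = 0 := by
    rw [← ((M.actAdjunction adj).homEquiv X Y).symm_apply_apply r.r,
      CategoryTheory.Adjunction.homEquiv_counit, h.eq_of_tgt ((M.act F).map _) 0, zero_comp]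
  rw [IsZero.iff_id_eq_zero, ← r.retract, hr, comp_zero]

end SubRep

end TwoRepresentations

end FinTwoRep

/-! ### Extension sets and the apex -/

theorem proposition25 {k : Type w₁} [Field k] [IsAlgClosed k]
    {C : Type u} [Bicategory.{w, v} C] [FinTwoRep.LocallyAdditive C]
    [FinTwoRep.FinitaryTwoCategory C k] (hC : FinTwoRep.WeaklyFiat C)
    (K N : FinTwoRep.FinitaryRep.{w, v, u, w₁, v₁, u₁} C k)
    (hK : K.IsTransitive) (hN : N.IsTransitive) :
    ∃ JK : Set (FinTwoRep.IndecOneMor C), K.IsApex JK ∧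
      ∀ Θ ∈ FinTwoRep.Dext N K,
        (∀ φ ∈ Θ, ∀ ψ ∈ JK, FinTwoRep.JLe φ ψ) ∧ (Θ ∩ JK).Nonempty := by
  open FinTwoRep in
  obtain ⟨z, hz, hmax⟩ := hK.exists_survives_forall_jLe
  refine ⟨twoSidedCell z, K.isApex_twoSidedCell hz hmax, ?_⟩
  rintro Θ ⟨⟨θ, hθ⟩, M, K', -, hK', hequiv, -, rfl⟩
  have le_z : ∀ φ ∈ K'.extensionSet, JLe φ z := by
    rintro _ ⟨-, x, -, y, hy, F, hF, X, Y, rfl, hX, hY, hs⟩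
    obtain ⟨r⟩ := hs.retract
    obtain ⟨S, hS⟩ := hC
    obtain ⟨adj⟩ := hS F
    obtain ⟨Z, hZ, hFZ⟩ := K'.exists_not_isZero_of_retract adj hY.1.1 (K'.mem_of_mem_indec hy hY) r
    by_contra hcon
    -- If `F` is not below `z`, it does not survive in `K`, so it annihilates the equivalent `K'`,
    -- contradicting `F Z ≠ 0`.
    refine hFZ ((K'.forall_isZero_iff hequiv F).2 (fun W => ?_) Z hZ)
    by_contra hW
    exact hcon (hmax _ (K.survives_of_not_isZero (x := ⟨x.pt, y.pt, .mk F hF⟩)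
      (IndecClass.represents_mk hF) hW))
  refine ⟨fun φ hφ ψ hψ => (le_z φ hφ).trans k hψ.1, ?_⟩
  obtain ⟨hedge, x, hx, y, hy, F, hF, X, Y, -, hX, hY, hs⟩ := hθ
  obtain ⟨rY⟩ := hs.retract
  obtain ⟨G, hG⟩ := z.cls.exists_represents
  -- `G` survives in `K`, hence does not annihilate `K'`; Krull-Schmidt makes the witness
  -- indecomposable.
  obtain ⟨Y', hY'K, hY', hGY'⟩ : ∃ Y', K'.mem z.src Y' ∧ Indecomposable Y' ∧
      ¬ IsZero ((M.act G).obj Y') := by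
    by_contra! H
    obtain ⟨W, hW⟩ := hz.exists_not_isZero hG
    refine hW ((K'.forall_isZero_iff hequiv G).1 (fun V hV => ?_) W)
    by_contra hGV
    obtain ⟨V', r, hV', hGV'⟩ :=
      FinitaryCategory.exists_local_retract_not_isZero k (M.act G) hGV
    exact hGV' (H V' (K'.mem_of_retract r hV) (indecomposable_of_isLocalRing hV'))
  obtain ⟨H, ⟨rY'⟩⟩ := (hK'.2 y hy ⟨_, .mk Y' hY'⟩
    ⟨Y', IndecClass.represents_mk hY', hY'K⟩).exists_retract hY (IndecClass.represents_mk hY')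
  obtain ⟨W, rW, hW⟩ := FinitaryCategory.exists_local_retract k hGY'
  have hWK : K'.mem z.tgt W := K'.mem_of_retract rW (K'.act_mem G Y' hY'K)
  have rWX : Retract W ((M.evaluation X z.tgt).obj ((F ≫ H) ≫ G)) :=
    (rW.trans ((rY'.trans (rY.map (M.act H))).map (M.act G))).trans
      (Retract.ofIso (M.actCompIso (F ≫ H) G X ≪≫ (M.act G).mapIso (M.actCompIso F H X)).symm)
  -- Evaluation at `X` is additive in the 1-morphism, so the local object `W` is already a summand
  -- of `L X` for one indecomposable summand `L` of the composite.
  obtain ⟨L, rL, rWL, hL⟩ := FinitaryCategory.exists_retract_map k (M.evaluation X z.tgt) rWX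
  have hL := IndecClass.represents_mk (indecomposable_of_isLocalRing hL)
  have hW := IndecClass.represents_mk (indecomposable_of_isLocalRing hW)
  have : IsIdempotentComplete (M.obj z.tgt) := FinitaryCategory.toIsIdempotentComplete k
  have hmem : (⟨x.pt, z.tgt, .mk L hL.1⟩ : IndecOneMor C) ∈ K'.extensionSet :=
    ⟨hedge, x, hx, ⟨z.tgt, .mk W hW.1⟩, ⟨W, hW, hWK⟩, L, hL.1, X, W, rfl, hX, hW,
      isSummand_of_retract rWL⟩
  refine ⟨_, hmem, ?_, le_z _ hmem⟩
  -- `G` is the last factor of the composite containing `L`, so `L` lies above `z`.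
  exact jLe_of_retract (y := ⟨x.pt, z.tgt, .mk L hL.1⟩) k hG hL (F ≫ H) (𝟙 _)
    (rL.trans (Retract.ofIso (whiskerLeftIso _ (ρ_ _).symm)))
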